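/- **Conventions.** Let $(X,d)$ be a nonempty compact metric space with a fixed sequence $(s_k)_{k\in\mathbb N}$ whose image is dense in $X$ (a compact computable metric space). An *oracle* for $x\in X$ is a function $\varphi:\mathbb N\to\mathbb N$ with $d(x,s_{\varphi(n)})<2^{-n}$ for all $n$. A Turing machine *computes* $x$ if it computes an oracle for $x$; then $x$ is a computable point. The same notions apply to $\mathbb R^m$ with the Euclidean norm and a standard effective enumeration of $\mathbb Q^m$. A map $g:X\to Y$ between such spaces, where $Y$ has dense sequence $(t_k)$, is *computable* if there is one oracle Turing machine which, given any oracle for any $x\in X$ and any $n\in\mathbb N$, outputs an index $k$ with $d_Y(t_k,g(x))<2^{-n}$. A compact set $A\subset\mathbb R^m$ is *computable* if there is a Turing machine which on input $n$ outputs a finite list of pairs $(k_i,l_i)\in\mathbb N\times\mathbb Z$ such that the union of the closed balls $\overline B(t_{k_i},2^{-l_i})$ with rational centres has Hausdorff distance less than $2^{-n}$ to $A$. Let $f:X\to X$ be continuous and computable, let $\mathcal M$ be the set of $f$-invariant Borel probability measures on $X$, and for $\Phi=(\Phi_1,\dots,\Phi_m)\in C(X,\mathbb R^m)$ let $$\mathrm{Rot}(\Phi)=\Big\{\Big(\int\Phi_1\,d\mu,\dots,\int\Phi_m\,d\mu\Big):\mu\in\mathcal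 M\Big\}.$$ For a periodic point $q$ of $f$ with smallest period $r$ let $\mu_q=\frac1r\sum_{h=0}^{r-1}\delta_{f^h(q)}$. **Theorem.** Suppose that $\Phi\in C(X,\mathbb R^m)$ is computable, and let $\omega:\mathbb N\to\mathbb N$ be a global modulus of continuity of $\Phi$, that is, $d(x,y)<2^{-\omega(k)}$ implies $\|\Phi(x)-\Phi(y)\|<2^{-k}$ for all $k\in\mathbb N$ and $x,y\in X$. Suppose that there is a Turing machine $\psi$ that outputs, on each input $n\in\mathbb N$, 1. a finite list of Turing machines that compute points $p_1,\dots,p_k\in X$, and 2. a finite list of pairs, each consisting of a Turing machine that computes a periodic point $q_j$ of $f$ and a period $m_j\ge1$ of $q_j$ ($1\le j\le l$), such that there is a partition $\{P_1,\dots,P_k\}$ of $X$ into Borel sets with 1. $p_i\in P_i$ for each $i$, 2. $\operatorname{diam}(P_i)<2^{-\omega(n+1)-1}$ for each $i$, and 3. for every $\mu\in\mathcal M$ there is $\nu\in\operatorname{conv}(\mu_{q_1},\dots,\mu_{q_l})$ with $\sum_{i=1}^k|\mu(P_i)-\nu(P_i)|<2^{-n}$. Then $\mathrm{Rot}(\Phi)$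 is (compact and) computable. -/

import Mathlib

open MeasureTheory

/-! ### Oracle machines -/

/-- Programs that may query an oracle `ℕ → ℕ`. They extend the programs `Nat.Partrec.Code` for the
partial recursive functions by one instruction, `oracle`, which queries the oracle. -/
inductive OracleCode : Type
  | zero : OracleCode
  | succ : OracleCode
  | left : OracleCode
  | right : OracleCode
  | oracle : OracleCode
  | pair : OracleCode → OracleCode → OracleCode
  | comp : OracleCode → OracleCode → OracleCode
  | prec : OracleCode → OracleCode → OracleCode
  | rfind' : OracleCode → OracleCode

/-- `c.eval φ n` is the output, if there is one, of the program `c` on input `n` with oracle `φ`.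
The clauses other than `oracle` are those of `Nat.Partrec.Code.eval`. -/
def OracleCode.eval (φ : ℕ → ℕ) : OracleCode → ℕ →. ℕ
  | .zero => fun _ => Part.some 0
  | .succ => fun n => Part.some (n + 1)
  | .left => fun n => Part.some n.unpair.1
  | .right => fun n => Part.some n.unpair.2
  | .oracle => fun n => Part.some (φ n)
  | .pair cf cg => fun n => Nat.pair <$> OracleCode.eval φ cf n <*> OracleCode.eval φ cg n
  | .comp cf cg => fun n => OracleCode.eval φ cg n >>= OracleCode.eval φ cf
  | .prec cf cg =>
    Nat.unpaired fun a n =>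
      n.rec (OracleCode.eval φ cf a) fun y IH => do
        let i ← IH
        OracleCode.eval φ cg (Nat.pair a (Nat.pair y i))
  | .rfind' cf =>
    Nat.unpaired fun a m =>
      (Nat.rfind fun n => (fun m => m = 0) <$> OracleCode.eval φ cf (Nat.pair a (n + m))).map (· + m)

/-! ### Computable metric spaces, points, functions and sets -/

/-- The structure of a computable metric space on a metric space: a sequence with dense image. -/
structure ComputableMetricSpace (X : Type*) [MetricSpace X] where
  /-- the dense sequence -/
  pt : ℕ → X
  dense : DenseRange pt

namespace ComputableMetricSpace

variable {X Y : Type*} [MetricSpace X] [MetricSpace Y]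

/-- `φ` is an oracle for the point `x`. -/
def IsOracle (S : ComputableMetricSpace X) (φ : ℕ → ℕ) (x : X) : Prop :=
  ∀ n : ℕ, dist x (S.pt (φ n)) < (1 / 2 : ℝ) ^ n

/-- The Turing machine `c` computes the point `x`: it halts on every input, and the function that
it computes is an oracle for `x`. In particular `x` is a computable point. -/
def Computes (S : ComputableMetricSpace X) (c : Nat.Partrec.Code) (x : X) : Prop :=
  ∃ φ : ℕ → ℕ, (∀ n : ℕ, φ n ∈ c.eval n) ∧ S.IsOracle φ x

/-- `g : X → Y` is a computable function: one oracle machine, given any oracle for any point `x`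
(computable or not) and any `n`, outputs the index of a point of `Y` within `2⁻ⁿ` of `g x`. -/
def IsComputableFun (S : ComputableMetricSpace X) (T : ComputableMetricSpace Y) (g : X → Y) :
    Prop :=
  ∃ c : OracleCode, ∀ (x : X) (φ : ℕ → ℕ), S.IsOracle φ x →
    ∀ n : ℕ, ∃ k ∈ c.eval φ n, dist (T.pt k) (g x) < (1 / 2 : ℝ) ^ n

/-- `A` is a computable compact set: a Turing machine outputs, on input `n`, a finite list of pairs
`(k, l)` such that the union of the closed balls of centre `S.pt k` and radius `2⁻ˡ` has Hausdorff
distance less than `2⁻ⁿ` to `A`. (The extended Hausdorff distance is used, so that the distance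
between the empty set and a nonempty set is infinite.) -/
def IsComputableSet (S : ComputableMetricSpace X) (A : Set X) : Prop :=
  IsCompact A ∧ ∃ ψ : ℕ → List (ℕ × ℤ), Computable ψ ∧ ∀ n : ℕ,
    Metric.hausdorffEDist (⋃ b ∈ ψ n, Metric.closedBall (S.pt b.1) ((2 : ℝ) ^ (-b.2))) A <
      ENNReal.ofReal ((1 / 2 : ℝ) ^ n)

end ComputableMetricSpace

/-- The `k`-th rational point of `ℝᵐ`: `k` codes a finite list of triples of natural numbers, the
`i`-th triple `(a, b, c)` gives the `i`-th coordinate `(a - b) / (c + 1)`, and coordinates for which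
there is no triple are zero. -/
noncomputable def ratPoint (m k : ℕ) : EuclideanSpace ℝ (Fin m) :=
  WithLp.toLp 2 fun i =>
    let t := (Denumerable.ofNat (List (ℕ × ℕ × ℕ)) k).getD (i : ℕ) (0, 0, 0)
    ((t.1 : ℝ) - (t.2.1 : ℝ)) / ((t.2.2 : ℝ) + 1)

/-- Every point with rational coordinates is listed. -/
theorem exists_ratPoint_eq (m : ℕ) (r : Fin m → ℚ) :
    ∃ k, ratPoint m k = WithLp.toLp 2 fun i => (r i : ℝ) := by
  refine ⟨Encodable.encode (List.ofFn fun i : Fin m =>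
    (((r i).num.toNat, (-(r i).num).toNat, (r i).den - 1) : ℕ × ℕ × ℕ)), ?_⟩
  unfold ratPoint
  congr 1
  funext i
  have h1 : (((r i).num.toNat : ℝ) - ((-(r i).num).toNat : ℝ)) = ((r i).num : ℝ) := by
    have h := Int.toNat_sub_toNat_neg (r i).num
    exact_mod_cast congrArg (Int.cast : ℤ → ℝ) h
  have h2 : ((((r i).den - 1 : ℕ) : ℝ) + 1) = ((r i).den : ℝ) := by
    have h := Nat.sub_add_cancel (r i).den_pos
    exact_mod_cast congrArg (Nat.cast : ℕ → ℝ) h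
  simp only [Denumerable.ofNat_encode]
  simp [List.getD_eq_getElem?_getD, h1, h2]
  exact_mod_cast Rat.num_div_den (r i)

theorem denseRange_ratPoint (m : ℕ) : DenseRange (ratPoint m) := by
  have h : DenseRange fun r : Fin m → ℚ => (fun i => (r i : ℝ)) :=
    DenseRange.piMap fun _ => Rat.denseRange_cast
  have h2 : DenseRange fun r : Fin m → ℚ =>
      (WithLp.toLp 2 fun i => (r i : ℝ) : EuclideanSpace ℝ (Fin m)) :=
    (EuclideanSpace.equiv (Fin m) ℝ).symm.surjective.denseRange.comp h
      (EuclideanSpace.equiv (Fin m) ℝ).symm.continuous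
  refine Dense.mono ?_ h2
  rintro _ ⟨r, rfl⟩
  exact exists_ratPoint_eq m r

/-- `ℝᵐ` as a computable metric space, with its rational points. -/
noncomputable def euclideanCMS (m : ℕ) : ComputableMetricSpace (EuclideanSpace ℝ (Fin m)) where
  pt := ratPoint m
  dense := denseRange_ratPoint m

/-! ### Invariant measures and rotation sets -/

section Dynamics

variable {X : Type*} [MeasurableSpace X]

/-- The set of `f`-invariant probability measures. -/
def invariantMeasures (f : X → X) : Set (Measure X) :=
  {μ | IsProbabilityMeasure μ ∧ MeasurePreserving f μ μ}

/-- The rotation vector `(∫ Φ₁ dμ, …, ∫ Φₘ dμ)`. -/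
noncomputable def rotationVector {m : ℕ} (Φ : X → EuclideanSpace ℝ (Fin m)) (μ : Measure X) :
    EuclideanSpace ℝ (Fin m) :=
  WithLp.toLp 2 fun i => ∫ x, Φ x i ∂μ

/-- The generalized rotation set of `Φ` with respect to `f`. -/
def rotationSet {m : ℕ} (f : X → X) (Φ : X → EuclideanSpace ℝ (Fin m)) :
    Set (EuclideanSpace ℝ (Fin m)) :=
  rotationVector Φ '' invariantMeasures f

/-- The periodic point measure `(δ_x + … + δ_{f^{n-1} x}) / n` of a periodic point `x` with smallest
period `n`. -/
noncomputable def periodicMeasure (f : X → X) (x : X) : Measure X :=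
  ((Function.minimalPeriod f x : ENNReal))⁻¹ •
    ∑ h ∈ Finset.range (Function.minimalPeriod f x), Measure.dirac (f^[h] x)

end Dynamics

/-- `ω` is a global modulus of continuity of `g`: if `dist x y < 2^{-ω k}` then
`dist (g x) (g y) < 2⁻ᵏ`. -/
def IsGlobalModulus {X Y : Type*} [MetricSpace X] [MetricSpace Y] (g : X → Y) (ω : ℕ → ℕ) : Prop :=
  ∀ (k : ℕ) (x y : X), dist x y < (1 / 2 : ℝ) ^ ω k → dist (g x) (g y) < (1 / 2 : ℝ) ^ k

/-- `P` is a partition of `X` into Borel sets. (Nonemptiness of the parts is not required here.) -/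
def IsBorelPartition {X : Type*} [MeasurableSpace X] {k : ℕ} (P : Fin k → Set X) : Prop :=
  (∀ i, MeasurableSet (P i)) ∧ Pairwise (fun i j => Disjoint (P i) (P j)) ∧ ⋃ i, P i = Set.univ

/-- The finite data that have to be produced for a given `n`. The list `A` holds Turing machines that
compute points `p i`. The list `B` holds pairs of a Turing machine that computes a periodic point
`q j` and a (not necessarily smallest) period of `q j`. There is a partition of `X` into Borel sets
`P i` containing `p i`, of diameter less than `2^{-ω(n+1)-1}`, such that every invariant probability
measure is `2⁻ⁿ`-close on the partition to a convex combination of the measures of the `q j`. -/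
def IsApproximatingData {X : Type*} [MetricSpace X] [MeasurableSpace X]
    (S : ComputableMetricSpace X) (f : X → X) (ω : ℕ → ℕ) (n : ℕ)
    (A : List Nat.Partrec.Code) (B : List (Nat.Partrec.Code × ℕ)) : Prop :=
  ∃ (p : Fin A.length → X) (q : Fin B.length → X),
    (∀ i, S.Computes (A.get i) (p i)) ∧
    (∀ j, S.Computes (B.get j).1 (q j) ∧ 0 < (B.get j).2 ∧
      Function.IsPeriodicPt f (B.get j).2 (q j)) ∧
    ∃ P : Fin A.length → Set X, IsBorelPartition P ∧
      (∀ i, p i ∈ P i) ∧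
      (∀ i, Metric.diam (P i) < (1 / 2 : ℝ) ^ (ω (n + 1) + 1)) ∧
      ∀ μ ∈ invariantMeasures f, ∃ w : Fin B.length → NNReal, ∑ j, w j = 1 ∧
        ∑ i, |μ.real (P i) - (∑ j, w j • periodicMeasure f (q j)).real (P i)| < (1 / 2 : ℝ) ^ n

/-! ### Invariant measures and rotation vectors -/

section Rotation

variable {X : Type*} [MeasurableSpace X] {f : X → X}

/-! Compactness is weak compactness of the space of probability measures. For computability, replace
an integral by the Riemann sum of `Φ` over the tagged partition. The modulus makes `Φ` vary by at
most `2^{-(n+1)}` on each part, so two measures whose masses on the parts differ by at most `2⁻ⁿ` in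
total have rotation vectors within `(1 + C) 2⁻ⁿ`, where `C` bounds `‖Φ‖` (`dist_rotationVector_le`).
Hence the rotation set is that close to the convex hull of the rotation vectors of the `q j`, and it
contains this hull because it is convex (`IsApproximatingData.exists_dist_le`).

The hull can be computed approximately. The rotation vector of `q j` is a Birkhoff average over any
known period, and a program for `q j` is turned effectively into programs for the values of `Φ`
along the orbit (`exists_computable_birkhoffAverage`). Real weights are rounded to multiples of `1 /
K` (`exists_list_dist_sum_smul_le`), so the averages of all `K`-tuples of approximate vertices form
a finite net of rational points. -/

theorem periodicMeasure_mem_invariantMeasures (hf : Measurable f) {q : X}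
    (hq : q ∈ Function.periodicPts f) : periodicMeasure f q ∈ invariantMeasures f := by
  have hr : 0 < Function.minimalPeriod f q := Function.minimalPeriod_pos_of_mem_periodicPts hq
  have hr' : (Function.minimalPeriod f q : ENNReal) ≠ 0 := by exact_mod_cast hr.ne'
  refine ⟨⟨?_⟩, hf, ?_⟩
  · simp [periodicMeasure, ENNReal.inv_mul_cancel hr' (ENNReal.natCast_ne_top _)]
  · unfold periodicMeasure
    rw [Measure.map_smul]
    congr 1
    rw [Measure.map_finset_sum hf.aemeasurable]
    simp only [Measure.map_dirac' hf, ← Function.iterate_succ_apply' f]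
    obtain ⟨r, hr1⟩ := Nat.exists_eq_succ_of_ne_zero hr.ne'
    have h := Function.iterate_minimalPeriod (f := f) (x := q)
    rw [hr1] at h ⊢
    rw [Finset.sum_range_succ, Finset.sum_range_succ', h]
    rfl

theorem sum_smul_mem_invariantMeasures {ι : Type*} [Fintype ι] (hf : Measurable f)
    {w : ι → NNReal} (hw : ∑ j, w j = 1) {ν : ι → Measure X}
    (hν : ∀ j, ν j ∈ invariantMeasures f) : ∑ j, w j • ν j ∈ invariantMeasures f := by
  refine ⟨⟨?_⟩, hf, ?_⟩
  · have h : ∀ j, ν j Set.univ = 1 := fun j => (hν j).1.measure_univ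
    simp only [Measure.coe_finsetSum, Finset.sum_apply, Measure.smul_apply, h]
    simp only [ENNReal.smul_def, smul_eq_mul, mul_one]
    exact_mod_cast congrArg ((↑) : NNReal → ENNReal) hw
  · rw [Measure.map_finset_sum hf.aemeasurable]
    exact Finset.sum_congr rfl fun j _ => by rw [Measure.map_smul, (hν j).2.map_eq]

/-- Needed because the supplied period may be a proper multiple of the smallest one. -/
theorem birkhoffSum_mul_of_isPeriodicPt {α M : Type*} [AddCommMonoid M] {f : α → α} {r : ℕ} {q : α}
    (hq : Function.IsPeriodicPt f r q) (g : α → M) (k : ℕ) :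
    birkhoffSum f g (r * k) q = k • birkhoffSum f g r q := by
  induction k with
  | zero => simp
  | succ k ih =>
    rw [Nat.mul_succ, birkhoffSum_add, ih, (hq.mul_const k).eq, succ_nsmul]

end Rotation

/-! ### Rotation vectors of measures on a compact space -/

section Compact

variable {X : Type*} [MetricSpace X] [CompactSpace X] [MeasurableSpace X] [BorelSpace X]
  {m : ℕ}

theorem ContinuousMap.integrable_of_compactSpace (Φ : C(X, EuclideanSpace ℝ (Fin m)))
    (μ : Measure X) [IsFiniteMeasure μ] : Integrable Φ μ :=
  Φ.continuous.integrable_of_hasCompactSupport (HasCompactSupport.of_compactSpace _)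

theorem rotationVector_eq_integral (Φ : C(X, EuclideanSpace ℝ (Fin m))) (μ : Measure X)
    [IsFiniteMeasure μ] : rotationVector Φ μ = ∫ x, Φ x ∂μ := by
  ext i
  exact (EuclideanSpace.proj (𝕜 := ℝ) i).integral_comp_comm (Φ.integrable_of_compactSpace μ)

/-- Push-forward by a continuous map is weakly continuous, so the invariant measures are closed in
the weakly compact space of probability measures; integration of each coordinate of `Φ` is weakly
continuous. -/
theorem isCompact_rotationSet {f : X → X} (hf : Continuous f)
    (Φ : C(X, EuclideanSpace ℝ (Fin m))) : IsCompact (rotationSet f Φ) := by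
  have h : rotationSet f Φ = (fun μ : ProbabilityMeasure X => rotationVector Φ (μ : Measure X)) ''
      {μ | μ.map hf.measurable.aemeasurable = μ} := by
    ext v
    constructor
    · rintro ⟨μ, ⟨hp, hμ⟩, rfl⟩
      exact ⟨⟨μ, hp⟩, Subtype.ext hμ.map_eq, rfl⟩
    · rintro ⟨μ, hμ, rfl⟩
      exact ⟨μ, ⟨inferInstance, hf.measurable, congrArg Subtype.val hμ⟩, rfl⟩
  rw [h]
  refine (isClosed_eq (ProbabilityMeasure.continuous_map hf) continuous_id).isCompact.image ?_
  refine (PiLp.continuous_toLp 2 _).comp (continuous_pi fun i => ?_)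
  exact ProbabilityMeasure.continuous_integral_boundedContinuousFunction
    (BoundedContinuousFunction.mkOfCompact
      ⟨fun x => Φ x i, (EuclideanSpace.proj (𝕜 := ℝ) i).continuous.comp Φ.continuous⟩)

theorem rotationVector_sum_smul {ι : Type*} [Fintype ι] (Φ : C(X, EuclideanSpace ℝ (Fin m)))
    (w : ι → NNReal) (ν : ι → Measure X) [∀ j, IsFiniteMeasure (ν j)] :
    rotationVector Φ (∑ j, w j • ν j) = ∑ j, (w j : ℝ) • rotationVector Φ (ν j) := by
  have : ∀ j, IsFiniteMeasure (w j • ν j) := fun j => inferInstance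
  simp only [rotationVector_eq_integral]
  rw [integral_finsetSum_measure fun j _ => Φ.integrable_of_compactSpace _]
  exact Finset.sum_congr rfl fun j _ => integral_smul_nnreal_measure _ _

theorem convex_rotationSet {f : X → X} (hf : Continuous f) (Φ : C(X, EuclideanSpace ℝ (Fin m))) :
    Convex ℝ (rotationSet f Φ) := by
  rintro _ ⟨μ, hμ, rfl⟩ _ ⟨ν, hν, rfl⟩ a b ha hb hab
  lift a to NNReal using ha
  lift b to NNReal using hb
  have h1 := hμ.1
  have h2 := hν.1
  have h3 : ∀ j, ![μ, ν] j ∈ invariantMeasures f := by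
    intro j; fin_cases j <;> simpa
  have h4 : ∀ j, IsFiniteMeasure (![μ, ν] j) := fun j => have := (h3 j).1; inferInstance
  refine ⟨_, sum_smul_mem_invariantMeasures hf.measurable (w := ![a, b]) ?_ h3, ?_⟩
  · rw [Fin.sum_univ_two]
    exact_mod_cast hab
  · rw [rotationVector_sum_smul, Fin.sum_univ_two]
    rfl

/-- Running several times through the orbit does not change the average. This removes the smallest
period, which need not be known to the machine. -/
theorem rotationVector_periodicMeasure {f : X → X} (hf : Measurable f)
    (Φ : C(X, EuclideanSpace ℝ (Fin m))) {n : ℕ} (hn : 0 < n) {q : X}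
    (hq : Function.IsPeriodicPt f n q) :
    rotationVector Φ (periodicMeasure f q) = birkhoffAverage ℝ f Φ n q := by
  have hp : q ∈ Function.periodicPts f := ⟨n, hn, hq⟩
  have hfin : IsProbabilityMeasure (periodicMeasure f q) :=
    (periodicMeasure_mem_invariantMeasures hf hp).1
  obtain ⟨k, rfl⟩ := hq.minimalPeriod_dvd
  have hk : (k : ℝ) ≠ 0 := by
    rintro h
    simp_all
  have hr : (Function.minimalPeriod f q : ℝ) ≠ 0 := by
    exact_mod_cast (Function.minimalPeriod_pos_of_mem_periodicPts hp).ne'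
  rw [rotationVector_eq_integral, birkhoffAverage, birkhoffSum_mul_of_isPeriodicPt
    (Function.isPeriodicPt_minimalPeriod f q), periodicMeasure, integral_smul_measure,
    integral_finsetSum_measure fun j _ => Φ.integrable_of_compactSpace _]
  simp only [integral_dirac]
  rw [← Nat.cast_smul_eq_nsmul ℝ, smul_smul, birkhoffSum]
  congr 1
  push_cast
  rw [ENNReal.toReal_inv, ENNReal.toReal_natCast]
  field_simp

/-- Each vector is within `δ` of its Riemann sum with tags `p i`, and the two Riemann sums differ
only through the masses of the parts. -/
theorem dist_rotationVector_le {k : ℕ} (Φ : C(X, EuclideanSpace ℝ (Fin m))) {P : Fin k → Set X}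
    (hP : IsBorelPartition P) {p : Fin k → X} {δ : ℝ} (hδ : ∀ i, ∀ x ∈ P i, dist (Φ x) (Φ (p i)) ≤ δ)
    {C : ℝ} (hC : ∀ x, ‖Φ x‖ ≤ C) (μ ν : Measure X) [IsProbabilityMeasure μ]
    [IsProbabilityMeasure ν] :
    dist (rotationVector Φ μ) (rotationVector Φ ν) ≤
      2 * δ + C * ∑ i, |μ.real (P i) - ν.real (P i)| := by
  have key : ∀ (μ : Measure X) [IsProbabilityMeasure μ],
      dist (rotationVector Φ μ) (∑ i, μ.real (P i) • Φ (p i)) ≤ δ := by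
    intro μ _
    have h1 : rotationVector Φ μ = ∑ i, ∫ x in P i, Φ x ∂μ := by
      rw [rotationVector_eq_integral, ← setIntegral_univ, ← hP.2.2]
      exact integral_iUnion_fintype hP.1 hP.2.1 fun i =>
        (Φ.integrable_of_compactSpace μ).integrableOn
    have h2 : ∑ i, μ.real (P i) = 1 := by
      rw [← measureReal_iUnion_fintype hP.2.1 hP.1, hP.2.2, probReal_univ]
    calc dist (rotationVector Φ μ) (∑ i, μ.real (P i) • Φ (p i))
        ≤ ∑ i, δ * μ.real (P i) := by
          rw [h1]
          refine (dist_sum_sum_le _ _ _).trans (Finset.sum_le_sum fun i _ => ?_)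
          rw [← setIntegral_const, dist_eq_norm, ← integral_sub
            (Φ.integrable_of_compactSpace μ).integrableOn (integrable_const _)]
          refine norm_setIntegral_le_of_norm_le_const (measure_lt_top _ _) fun x hx => ?_
          rw [← dist_eq_norm]
          exact hδ i x hx
      _ = δ := by rw [← Finset.mul_sum, h2, mul_one]
  have h3 : dist (∑ i, μ.real (P i) • Φ (p i)) (∑ i, ν.real (P i) • Φ (p i)) ≤
      C * ∑ i, |μ.real (P i) - ν.real (P i)| := by
    rw [Finset.mul_sum]
    refine (dist_sum_sum_le _ _ _).trans (Finset.sum_le_sum fun i _ => ?_)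
    rw [dist_eq_norm, ← sub_smul, norm_smul, mul_comm, Real.norm_eq_abs]
    exact mul_le_mul_of_nonneg_right (hC _) (abs_nonneg _)
  calc dist (rotationVector Φ μ) (rotationVector Φ ν)
      ≤ dist (rotationVector Φ μ) (∑ i, μ.real (P i) • Φ (p i)) +
          dist (∑ i, μ.real (P i) • Φ (p i)) (∑ i, ν.real (P i) • Φ (p i)) +
          dist (∑ i, ν.real (P i) • Φ (p i)) (rotationVector Φ ν) := dist_triangle4 _ _ _ _
    _ ≤ δ + C * ∑ i, |μ.real (P i) - ν.real (P i)| + δ :=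
      add_le_add (add_le_add (key μ) h3) (by rw [dist_comm]; exact key ν)
    _ = _ := by ring

end Compact

/-! ### Rounding the weights of a convex combination -/

theorem exists_list_dist_sum_smul_le {E : Type*} [SeminormedAddCommGroup E] [NormedSpace ℝ E]
    {l : ℕ} (u : Fin l → E) {C : ℝ} (hC : ∀ j, ‖u j‖ ≤ C) (w : Fin l → NNReal)
    (hw : ∑ j, w j = 1) {K : ℕ} (hK : 0 < K) :
    ∃ T : List (Fin l), T.length = K ∧
      dist (∑ j, (w j : ℝ) • u j) ((K : ℝ)⁻¹ • (T.map u).sum) ≤ l * C / K := by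
  -- The cumulative weights are rounded instead of the weights themselves: the multiplicities `k j`
  -- then telescope to exactly `K`.
  set W : ℕ → NNReal := fun s => ∑ i ∈ Finset.range s, if h : i < l then w ⟨i, h⟩ else 0 with hW
  have hWl : W l = 1 := by rw [← hw, hW, Finset.sum_fin_eq_sum_range]
  set g : ℕ → ℕ := fun s => ⌊(K : NNReal) * W s⌋₊ with hg
  have hWs : ∀ j : Fin l, W (j + 1) = W j + w j := fun j => by
    simp [hW, Finset.sum_range_succ]
  have hWmono : Monotone W := monotone_nat_of_le_succ fun s => by
    simp [hW, Finset.sum_range_succ]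
  have hgmono : Monotone g := fun a b hab => Nat.floor_mono (by gcongr; exact hWmono hab)
  set k : Fin l → ℕ := fun j => g (j + 1) - g j with hk
  have hksum : ∑ j, k j = K := by
    rw [hk, Fin.sum_univ_eq_sum_range (fun s => g (s + 1) - g s) l, Finset.sum_range_tsub hgmono]
    simp only [hg, hWl, mul_one, Nat.floor_natCast]
    simp [hW]
  refine ⟨(List.finRange l).flatMap fun j => List.replicate (k j) j, ?_, ?_⟩
  · rw [List.length_flatMap]
    simp only [List.length_replicate]
    rw [← hksum, ← List.ofFn_eq_map, List.sum_ofFn]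
  · have h1 : (((List.finRange l).flatMap fun j => List.replicate (k j) j).map u).sum =
        ∑ j, k j • u j := by
      rw [List.map_flatMap, List.flatMap, List.sum_flatten, List.map_map]
      simp only [Function.comp_def]
      simp only [List.map_replicate, List.sum_replicate]
      rw [← List.ofFn_eq_map, List.sum_ofFn]
    have hK' : (0 : ℝ) < K := by exact_mod_cast hK
    rw [h1, Finset.smul_sum]
    calc _ ≤ ∑ j : Fin l, C / K := by
          refine (dist_sum_sum_le _ _ _).trans (Finset.sum_le_sum fun j _ => ?_)
          rw [← Nat.cast_smul_eq_nsmul ℝ, smul_smul, dist_eq_norm, ← sub_smul, norm_smul]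
          have h2 : |(w j : ℝ) - (K : ℝ)⁻¹ * k j| ≤ 1 / K := by
            have e1 : (w j : ℝ) - (K : ℝ)⁻¹ * k j = (K * w j - k j) / K := by field_simp
            rw [e1, abs_div, abs_of_pos hK']
            gcongr
            have e2 : (k j : ℝ) = g (j + 1) - g j := by
              rw [hk, Nat.cast_sub (hgmono (Nat.le_succ _))]
            have e3 : (W (j + 1) : ℝ) = W j + w j := by rw [hWs]; push_cast; rfl
            have a1 : ((g j : ℝ)) ≤ K * W j := by
              -- Both floor errors lie in `[0, 1)`, so their difference, which is the error of `k
              -- j`, is at most 1 in absolute value.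
              exact_mod_cast Nat.floor_le (a := (K : NNReal) * W j) (zero_le)
            have a2 : (K * W j : ℝ) < g j + 1 := by
              exact_mod_cast Nat.lt_floor_add_one ((K : NNReal) * W j)
            have b1 : ((g (j + 1) : ℝ)) ≤ K * W (j + 1) := by
              exact_mod_cast Nat.floor_le (a := (K : NNReal) * W (j + 1)) (zero_le)
            have b2 : (K * W (j + 1) : ℝ) < g (j + 1) + 1 := by
              exact_mod_cast Nat.lt_floor_add_one ((K : NNReal) * W (j + 1))
            rw [e3, mul_add] at b1 b2
            rw [e2, abs_le]
            constructor <;> linarith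
          calc _ ≤ 1 / K * C := mul_le_mul h2 (hC j) (norm_nonneg _) (by positivity)
            _ = C / K := by ring
      _ = l * C / K := by rw [Finset.sum_const, Finset.card_univ, Fintype.card_fin, nsmul_eq_mul]; ring

open Nat.Partrec (Code)

/-! ### Substituting a program for the oracle -/

/-- The program obtained from an oracle program by answering oracle queries with the program `d`. -/
def OracleCode.subst (d : Code) : OracleCode → Code
  | .zero => .zero
  | .succ => .succ
  | .left => .left
  | .right => .right
  | .oracle => d
  | .pair cf cg => .pair (cf.subst d) (cg.subst d)
  | .comp cf cg => .comp (cf.subst d) (cg.subst d)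
  | .prec cf cg => .prec (cf.subst d) (cg.subst d)
  | .rfind' cf => .rfind' (cf.subst d)

theorem OracleCode.eval_subst {d : Code} {φ : ℕ → ℕ} (h : ∀ n, φ n ∈ d.eval n) (c : OracleCode) :
    (c.subst d).eval = c.eval φ := by
  induction c with
  | oracle => exact funext fun n => Part.eq_some_iff.2 (h n)
  | zero => rfl
  | succ => rfl
  | left => rfl
  | right => rfl
  | pair cf cg hf hg => simp only [subst, Code.eval, OracleCode.eval, hf, hg]; rfl
  | comp cf cg hf hg => simp only [subst, Code.eval, OracleCode.eval, hf, hg]; rfl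
  | prec cf cg hf hg => simp only [subst, Code.eval, OracleCode.eval, hf, hg]; rfl
  | rfind' cf hf => simp only [subst, Code.eval, OracleCode.eval, hf]; rfl

theorem OracleCode.primrec_subst (c : OracleCode) : Primrec fun d : Code => c.subst d := by
  induction c with
  | oracle => exact Primrec.id
  | zero => exact Primrec.const _
  | succ => exact Primrec.const _
  | left => exact Primrec.const _
  | right => exact Primrec.const _
  | pair cf cg hf hg => exact Code.primrec₂_pair.comp hf hg
  | comp cf cg hf hg => exact Code.primrec₂_comp.comp hf hg
  | prec cf cg hf hg => exact Code.primrec₂_prec.comp hf hg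
  | rfind' cf hf => exact Code.primrec_rfind'.comp hf

/-- Substitution makes a computable function act on programs for points, uniformly in the program.
For a self-map this action can be iterated. -/
theorem ComputableMetricSpace.IsComputableFun.exists_primrec_code {X Y : Type*} [MetricSpace X]
    [MetricSpace Y] {S : ComputableMetricSpace X} {T : ComputableMetricSpace Y} {g : X → Y}
    (hg : S.IsComputableFun T g) :
    ∃ F : Code → Code, Primrec F ∧ ∀ d x, S.Computes d x → T.Computes (F d) (g x) := by
  obtain ⟨c, hc⟩ := hg
  refine ⟨fun d => c.subst d, c.primrec_subst, fun d x ⟨φ, hφ, hx⟩ => ?_⟩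
  choose ρ hρ hρ' using hc x φ hx
  refine ⟨ρ, fun n => ?_, fun n => ?_⟩
  · rw [OracleCode.eval_subst hφ]
    exact hρ n
  · rw [dist_comm]
    exact hρ' n

/-! ### Lists and partial recursive functions -/

/-- The partial function `g` is evaluated at the first `n` entries of the list `l`. -/
def List.partialTakeMap {β σ : Type*} (l : List β) (g : β →. σ) (n : ℕ) : Part (List σ) :=
  n.rec (Part.some []) fun i IH =>
    IH.bind fun r => (l[i]? : Part β).bind fun b => (g b).map fun s => r ++ [s]

/-- Halting is required only on the entries of `l`, since an arbitrary program need not compute a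
point. -/
theorem List.exists_mem_partialTakeMap {β σ : Type*} {l : List β} {g : β →. σ}
    (h : ∀ b ∈ l, (g b).Dom) :
    ∃ r ∈ l.partialTakeMap g l.length, List.Forall₂ (fun b s => s ∈ g b) l r := by
  have key : ∀ n ≤ l.length, ∃ r ∈ l.partialTakeMap g n,
      List.Forall₂ (fun b s => s ∈ g b) (l.take n) r := by
    intro n
    induction n with
    | zero => exact fun _ => ⟨[], Part.mem_some _, by simp⟩
    | succ n ih =>
      intro hn
      obtain ⟨r, hr, hr'⟩ := ih (Nat.le_of_succ_le hn)
      obtain ⟨s, hs⟩ := Part.dom_iff_mem.1 (h l[n] (List.getElem_mem _))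
      refine ⟨r ++ [s], ?_, ?_⟩
      · refine Part.mem_bind hr (Part.mem_bind (a := l[n]) ?_ (Part.mem_map _ hs))
        simp [List.getElem?_eq_getElem (Nat.lt_of_succ_le hn)]
      · rw [List.take_succ_eq_append_getElem (Nat.lt_of_succ_le hn)]
        exact List.rel_append hr' (by simpa using hs)
  simpa using key l.length le_rfl

/-- The map over the list is a recursion on the index, so `Partrec.nat_rec` applies even though `g`
is only partial. -/
theorem Partrec.list_partialTakeMap {α β σ : Type*} [Primcodable α] [Primcodable β] [Primcodable σ]
    {f : α → List β} {g : α → β →. σ} {n : α → ℕ} (hf : Computable f) (hg : Partrec₂ g)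
    (hn : Computable n) : Partrec fun a => (f a).partialTakeMap (g a) (n a) := by
  refine Partrec.nat_rec (h := fun a p => ((f a)[p.1]? : Part β).bind fun b =>
    (g a b).map fun s => p.2 ++ [s]) hn (Computable.const ([] : List σ)).partrec ?_
  have h1 : Partrec fun p : α × ℕ × List σ => ((f p.1)[p.2.1]? : Part β) :=
    (Computable.list_getElem?.comp (hf.comp Computable.fst)
      ((Computable.fst (α := ℕ) (β := List σ)).comp Computable.snd)).ofOption
  have h2 : Partrec fun q : (α × ℕ × List σ) × β => g q.1.1 q.2 :=
    hg.comp (Computable.fst.comp Computable.fst) Computable.snd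
  have h3 : Computable fun q : ((α × ℕ × List σ) × β) × σ => q.1.1.2.2 :=
    Computable.snd.comp (Computable.snd.comp (Computable.fst.comp Computable.fst))
  exact h1.bind (h2.map (Computable.list_concat.comp h3 Computable.snd))

/-- All lists of length `K` with entries in `l`. -/
def List.tuples {α : Type*} (l : List α) (K : ℕ) : List (List α) :=
  K.rec [[]] fun _ ts => ts.flatMap fun t => l.map fun a => a :: t

theorem List.mem_tuples {α : Type*} {l : List α} {K : ℕ} {t : List α} :
    t ∈ l.tuples K ↔ t.length = K ∧ ∀ a ∈ t, a ∈ l := by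
  induction K generalizing t with
  | zero => cases t <;> simp [tuples]
  | succ K ih =>
    have h : l.tuples (K + 1) = (l.tuples K).flatMap fun t => l.map fun a => a :: t := rfl
    cases t with
    | nil => simp [h]
    | cons a t =>
      simp only [h, List.mem_flatMap, List.mem_map, List.cons.injEq, ih]
      aesop

theorem List.primrec_tuples {α : Type*} [Primcodable α] :
    Primrec₂ (List.tuples : List α → ℕ → List (List α)) := by
  refine Primrec.nat_rec' (f := fun p : List α × ℕ => p.2)
    (h := fun p q => q.2.flatMap fun t => p.1.map fun a => a :: t) Primrec.snd (Primrec.const ([[]] : List (List α))) ?_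
  refine Primrec.list_flatMap (f := fun q : (List α × ℕ) × ℕ × List (List α) => q.2.2)
    (Primrec.snd.comp Primrec.snd) ?_
  have h1 : Primrec₂ fun (q : (List α × ℕ) × ℕ × List (List α)) (_ : List α) => q.1.1 :=
    Primrec.fst.comp (Primrec.fst.comp Primrec.fst)
  refine Primrec.list_map (g := fun p (a : α) => a :: p.2) h1 ?_
  exact Primrec.list_cons.comp Primrec.snd (Primrec.snd.comp Primrec.fst)

/-! ### Averages of rational points -/

/-- The rational number coded by a triple of natural numbers. -/
noncomputable def tripleVal (t : ℕ × ℕ × ℕ) : ℝ :=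
  ((t.1 : ℝ) - (t.2.1 : ℝ)) / ((t.2.2 : ℝ) + 1)

/-- A code for the sum of two coded rational numbers. -/
def tripleAdd (s t : ℕ × ℕ × ℕ) : ℕ × ℕ × ℕ :=
  (s.1 * (t.2.2 + 1) + t.1 * (s.2.2 + 1), s.2.1 * (t.2.2 + 1) + t.2.1 * (s.2.2 + 1),
    (s.2.2 + 1) * (t.2.2 + 1) - 1)

/-- A code for the quotient of a coded rational number by a positive natural number. -/
def tripleDiv (t : ℕ × ℕ × ℕ) (n : ℕ) : ℕ × ℕ × ℕ :=
  (t.1, t.2.1, (t.2.2 + 1) * n - 1)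

theorem tripleVal_tripleAdd (s t : ℕ × ℕ × ℕ) :
    tripleVal (tripleAdd s t) = tripleVal s + tripleVal t := by
  -- Denominators are stored minus one; the truncated subtraction is exact because the product is
  -- positive.
  have h : (((s.2.2 + 1) * (t.2.2 + 1) - 1 : ℕ) : ℝ) = (s.2.2 + 1) * (t.2.2 + 1) - 1 := by
    rw [Nat.cast_sub (Nat.mul_pos (Nat.succ_pos _) (Nat.succ_pos _))]
    push_cast
    rfl
  simp only [tripleVal, tripleAdd, h]
  push_cast
  field_simp
  ring

theorem tripleVal_tripleDiv (t : ℕ × ℕ × ℕ) {n : ℕ} (hn : 0 < n) :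
    tripleVal (tripleDiv t n) = (n : ℝ)⁻¹ * tripleVal t := by
  have h : (((t.2.2 + 1) * n - 1 : ℕ) : ℝ) = (t.2.2 + 1) * n - 1 := by
    rw [Nat.cast_sub (Nat.mul_pos (Nat.succ_pos _) hn)]
    push_cast
    rfl
  have hn' : (n : ℝ) ≠ 0 := by exact_mod_cast hn.ne'
  simp only [tripleVal, tripleDiv, h]
  field_simp
  ring

/-- The triple that codes the `i`-th coordinate of the rational point with index `k`. -/
def ratCoord (i k : ℕ) : ℕ × ℕ × ℕ :=
  (Denumerable.ofNat (List (ℕ × ℕ × ℕ)) k).getD i (0, 0, 0)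

/-- An index of the average of the rational points with indices in the list `L`. -/
def ratAverage (m : ℕ) (L : List ℕ) : ℕ :=
  Encodable.encode (List.ofFn fun i : Fin m =>
    tripleDiv (L.foldr (fun k s => tripleAdd (ratCoord i k) s) (0, 0, 0)) L.length)

theorem ratPoint_apply (m k : ℕ) (i : Fin m) : ratPoint m k i = tripleVal (ratCoord i k) := rfl

theorem ratPoint_ratAverage (m : ℕ) {L : List ℕ} (hL : 0 < L.length) :
    ratPoint m (ratAverage m L) = (L.length : ℝ)⁻¹ • (L.map (ratPoint m)).sum := by
  have key : ∀ (i : Fin m) (L : List ℕ),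
      tripleVal (L.foldr (fun k s => tripleAdd (ratCoord i k) s) (0, 0, 0)) =
        (L.map (ratPoint m)).sum i := by
    intro i L
    induction L with
    | nil => simp [tripleVal]
    | cons k L ih =>
      rw [List.foldr_cons, tripleVal_tripleAdd, ih, List.map_cons, List.sum_cons]
      rfl
  ext i
  rw [ratPoint_apply, PiLp.smul_apply, smul_eq_mul, ← key, ← tripleVal_tripleDiv _ hL]
  simp [ratCoord, ratAverage, List.getD_eq_getElem?_getD]

theorem primrec₂_tripleAdd : Primrec₂ tripleAdd := by
  have a1 : Primrec fun p : (ℕ × ℕ × ℕ) × (ℕ × ℕ × ℕ) => p.1.1 := Primrec.fst.comp Primrec.fst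
  have a2 : Primrec fun p : (ℕ × ℕ × ℕ) × (ℕ × ℕ × ℕ) => p.1.2.1 :=
    Primrec.fst.comp (Primrec.snd.comp Primrec.fst)
  have a3 : Primrec fun p : (ℕ × ℕ × ℕ) × (ℕ × ℕ × ℕ) => p.1.2.2 + 1 :=
    Primrec.succ.comp (Primrec.snd.comp (Primrec.snd.comp Primrec.fst))
  have b1 : Primrec fun p : (ℕ × ℕ × ℕ) × (ℕ × ℕ × ℕ) => p.2.1 := Primrec.fst.comp Primrec.snd
  have b2 : Primrec fun p : (ℕ × ℕ × ℕ) × (ℕ × ℕ × ℕ) => p.2.2.1 :=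
    Primrec.fst.comp (Primrec.snd.comp Primrec.snd)
  have b3 : Primrec fun p : (ℕ × ℕ × ℕ) × (ℕ × ℕ × ℕ) => p.2.2.2 + 1 :=
    Primrec.succ.comp (Primrec.snd.comp (Primrec.snd.comp Primrec.snd))
  exact (Primrec.nat_add.comp (Primrec.nat_mul.comp a1 b3) (Primrec.nat_mul.comp b1 a3)).pair
    ((Primrec.nat_add.comp (Primrec.nat_mul.comp a2 b3) (Primrec.nat_mul.comp b2 a3)).pair
      (Primrec.nat_sub.comp (Primrec.nat_mul.comp a3 b3) (Primrec.const 1)))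

theorem primrec₂_tripleDiv : Primrec₂ tripleDiv := by
  have a1 : Primrec fun p : (ℕ × ℕ × ℕ) × ℕ => p.1.1 := Primrec.fst.comp Primrec.fst
  have a2 : Primrec fun p : (ℕ × ℕ × ℕ) × ℕ => p.1.2.1 :=
    Primrec.fst.comp (Primrec.snd.comp Primrec.fst)
  have a3 : Primrec fun p : (ℕ × ℕ × ℕ) × ℕ => p.1.2.2 + 1 :=
    Primrec.succ.comp (Primrec.snd.comp (Primrec.snd.comp Primrec.fst))
  exact a1.pair (a2.pair
    (Primrec.nat_sub.comp (Primrec.nat_mul.comp a3 Primrec.snd) (Primrec.const 1)))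

theorem primrec_ratCoord (i : ℕ) : Primrec (ratCoord i) :=
  (Primrec.list_getD (0, 0, 0)).comp (Primrec.ofNat _) (Primrec.const i)

theorem primrec_ratAverage (m : ℕ) : Primrec (ratAverage m) := by
  refine Primrec.encode.comp (Primrec.list_ofFn fun i => ?_)
  refine primrec₂_tripleDiv.comp ?_ Primrec.list_length
  refine Primrec.list_foldr (f := fun L : List ℕ => L)
    (h := fun _ p => tripleAdd (ratCoord i p.1) p.2) Primrec.id (Primrec.const (0, 0, 0)) ?_
  exact primrec₂_tripleAdd.comp ((primrec_ratCoord i).comp (Primrec.fst.comp Primrec.snd))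
    (Primrec.snd.comp Primrec.snd)

/-- Averaging does not amplify entrywise errors, so no extra precision is needed for long orbits or
long tuples. -/
theorem List.dist_smul_sum_le {E : Type*} [SeminormedAddCommGroup E] [NormedSpace ℝ E] {ε : ℝ}
    {K : ℕ} (hK : 0 < K) {l l' : List E} (h : List.Forall₂ (fun a b => dist a b ≤ ε) l l')
    (hl : l.length = K) : dist ((K : ℝ)⁻¹ • l.sum) ((K : ℝ)⁻¹ • l'.sum) ≤ ε := by
  have key : dist l.sum l'.sum ≤ l.length * ε := by
    clear hl
    induction h with
    | nil => simp
    | @cons a b l l' hab _ ih =>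
      rw [List.sum_cons, List.sum_cons, List.length_cons]
      push_cast
      have := dist_add_add_le a l.sum b l'.sum
      linarith
  have hK' : (0 : ℝ) < K := by exact_mod_cast hK
  rw [dist_smul₀, norm_inv, Real.norm_of_nonneg hK'.le, inv_mul_le_iff₀ hK', ← hl]
  exact key

theorem birkhoffAverage_eq_list_sum {X E : Type*} [AddCommGroup E] [Module ℝ E] (f : X → X)
    (g : X → E) (n : ℕ) (x : X) :
    birkhoffAverage ℝ f g n x = (n : ℝ)⁻¹ • ((List.range n).map fun h => g (f^[h] x)).sum := by
  rw [birkhoffAverage, birkhoffSum, Finset.sum_range, ← List.sum_ofFn, List.ofFn_eq_map,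
    ← List.map_coe_finRange_eq_range, List.map_map]
  rfl

/-! ### Computing Birkhoff averages -/

/-- Iterating the action of `f` on programs and then applying that of `Φ` gives programs for the
values along the orbit. Each is run at precision `n` and the resulting rational points are averaged
exactly. -/
theorem exists_computable_birkhoffAverage {X : Type*} [MetricSpace X] {S : ComputableMetricSpace X}
    {f : X → X} (hf : S.IsComputableFun S f) {m : ℕ} {Φ : X → EuclideanSpace ℝ (Fin m)}
    (hΦ : S.IsComputableFun (euclideanCMS m) Φ) {B : ℕ → List (Code × ℕ)} (hB : Computable B)
    (hval : ∀ n, ∀ b ∈ B n, 0 < b.2 ∧ ∃ x, S.Computes b.1 x) :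
    ∃ U : ℕ → List ℕ, Computable U ∧ ∀ n, List.Forall₂ (fun b s => ∀ x, S.Computes b.1 x →
      dist (ratPoint m s) (birkhoffAverage ℝ f Φ b.2 x) ≤ (1 / 2 : ℝ) ^ n) (B n) (U n) := by
  obtain ⟨F, hF, hF'⟩ := hf.exists_primrec_code
  obtain ⟨G, hG, hG'⟩ := hΦ.exists_primrec_code
  have hiter : ∀ d x, S.Computes d x → ∀ h, S.Computes (F^[h] d) (f^[h] x) := by
    intro d x hx h
    induction h with
    | zero => exact hx
    | succ h ih =>
      rw [Function.iterate_succ_apply', Function.iterate_succ_apply']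
      exact hF' _ _ ih
  let codes : Code × ℕ → List Code := fun b => (List.range b.2).map fun h => G (F^[h] b.1)
  have hcodes : Primrec codes :=
    Primrec.list_map (Primrec.list_range.comp Primrec.snd)
      (hG.comp (Primrec.nat_iterate Primrec.snd (Primrec.fst.comp Primrec.fst)
        (hF.comp Primrec.snd)))
  let vals : ℕ → Code × ℕ →. ℕ := fun n b =>
    ((codes b).partialTakeMap (fun c => c.eval n) (codes b).length).map (ratAverage m)
  have hvals : Partrec₂ vals := by
    refine Partrec.map ?_ ((primrec_ratAverage m).to_comp.comp Computable.snd)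
    have h1 : Computable fun p : ℕ × Code × ℕ => codes p.2 := hcodes.to_comp.comp Computable.snd
    refine Partrec.list_partialTakeMap h1 ?_ (Computable.list_length.comp h1)
    exact Code.eval_part.comp Computable.snd (Computable.fst.comp Computable.fst)
  have hspec : ∀ n b x, 0 < b.2 → S.Computes b.1 x → ∃ s ∈ vals n b,
      dist (ratPoint m s) (birkhoffAverage ℝ f Φ b.2 x) ≤ (1 / 2 : ℝ) ^ n := by
    intro n b x hb hx
    have hc : ∀ h, (euclideanCMS m).Computes (G (F^[h] b.1)) (Φ (f^[h] x)) := fun h =>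
      hG' _ _ (hiter _ _ hx h)
    obtain ⟨r, hr, hr'⟩ := List.exists_mem_partialTakeMap (l := codes b) (g := fun c => c.eval n)
      (by
        intro c hcb
        obtain ⟨h, -, rfl⟩ := List.mem_map.1 hcb
        obtain ⟨φ, hφ, -⟩ := hc h
        exact Part.dom_iff_mem.2 ⟨_, hφ n⟩)
    refine ⟨_, Part.mem_map _ hr, ?_⟩
    have hlen : r.length = b.2 := by rw [← hr'.length_eq]; simp [codes]
    rw [ratPoint_ratAverage m (hlen ▸ hb), hlen, birkhoffAverage_eq_list_sum]
    refine List.dist_smul_sum_le hb ?_ (by simpa using hlen)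
    rw [List.forall₂_map_left_iff, List.forall₂_map_right_iff]
    rw [List.forall₂_map_left_iff] at hr'
    refine hr'.flip.imp fun s h hs => ?_
    obtain ⟨φ, hφ, hφ'⟩ := hc h
    rw [Part.mem_unique hs (hφ n), dist_comm]
    exact (hφ' n).le
  have hdom : ∀ n, ∀ b ∈ B n, (vals n b).Dom := by
    intro n b hb
    obtain ⟨hb0, x, hx⟩ := hval n b hb
    obtain ⟨s, hs, -⟩ := hspec n b x hb0 hx
    exact Part.dom_iff_mem.2 ⟨s, hs⟩
  -- The choice is harmless: `U n` is the unique value of a partial recursive function that is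
  -- defined at every `n`.
  choose U hU hU' using fun n => List.exists_mem_partialTakeMap (hdom n)
  refine ⟨U, Partrec.of_eq_tot
    (Partrec.list_partialTakeMap hB hvals (Computable.list_length.comp hB)) hU, fun n => ?_⟩
  refine List.Forall₂.imp ?_
    ((List.forall₂_and_left (p := fun b => b ∈ B n) _ _).2 ⟨fun b hb => hb, hU' n⟩)
  rintro b s ⟨hb, hs⟩ x hx
  obtain ⟨s', hs', hd⟩ := hspec n b x (hval n b hb).1 hx
  rwa [Part.mem_unique hs hs']

/-! ### Approximating the rotation set by finite averages -/

theorem Convex.smul_list_sum_mem {E ι : Type*} [AddCommGroup E] [Module ℝ E] {s : Set E}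
    (hs : Convex ℝ s) {u : ι → E} (hu : ∀ j, u j ∈ s) {T : List ι} {K : ℕ} (hK : 0 < K)
    (hT : T.length = K) : (K : ℝ)⁻¹ • (T.map u).sum ∈ s := by
  subst hT
  have hK' : (T.length : ℝ) ≠ 0 := by exact_mod_cast hK.ne'
  have h : (T.map u).sum = ∑ i : Fin T.length, u (T.get i) := by
    rw [← List.sum_ofFn]
    congr 1
    exact List.ext_get (by simp) (by simp)
  rw [h, Finset.smul_sum]
  exact hs.sum_mem (fun _ _ => by positivity) (by simp [hK']) fun i _ => hu _

/-- Every point of the rotation set is close to the convex hull of the rotation vectors of the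
periodic points supplied by approximating data. -/
theorem IsApproximatingData.exists_dist_le {X : Type*} [MetricSpace X] [CompactSpace X]
    [MeasurableSpace X] [BorelSpace X] {S : ComputableMetricSpace X} {f : X → X}
    (hf : Continuous f) {m : ℕ} {Φ : C(X, EuclideanSpace ℝ (Fin m))} {ω : ℕ → ℕ}
    (hω : IsGlobalModulus Φ ω) {C : ℝ} (hC : ∀ x, ‖Φ x‖ ≤ C) {n : ℕ} {A : List Code}
    {B : List (Code × ℕ)} (h : IsApproximatingData S f ω n A B) :
    ∃ u : Fin B.length → EuclideanSpace ℝ (Fin m),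
      (∀ j, 0 < (B.get j).2 ∧ ∃ x, S.Computes (B.get j).1 x ∧
        u j = birkhoffAverage ℝ f Φ (B.get j).2 x) ∧
      (∀ j, u j ∈ rotationSet f Φ) ∧
      ∀ v ∈ rotationSet f Φ, ∃ w : Fin B.length → NNReal, ∑ j, w j = 1 ∧
        dist v (∑ j, (w j : ℝ) • u j) ≤ (1 + C) * (1 / 2 : ℝ) ^ n := by
  obtain ⟨p, q, -, hq, P, hP, hpP, hdiam, hμ⟩ := h
  have hM : ∀ j, periodicMeasure f (q j) ∈ invariantMeasures f := fun j =>
    periodicMeasure_mem_invariantMeasures hf.measurable ⟨_, (hq j).2.1, (hq j).2.2⟩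
  have hfin : ∀ j, IsProbabilityMeasure (periodicMeasure f (q j)) := fun j => (hM j).1
  refine ⟨fun j => rotationVector Φ (periodicMeasure f (q j)), fun j => ⟨(hq j).2.1, q j, (hq j).1,
    rotationVector_periodicMeasure hf.measurable Φ (hq j).2.1 (hq j).2.2⟩,
    fun j => ⟨_, hM j, rfl⟩, ?_⟩
  rintro _ ⟨μ, hμM, rfl⟩
  obtain ⟨w, hw, hwμ⟩ := hμ μ hμM
  refine ⟨w, hw, ?_⟩
  have hμp := hμM.1
  have hνp := (sum_smul_mem_invariantMeasures hf.measurable hw hM).1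
  -- The dense sequence shows that `X` is nonempty.
  have hC0 : 0 ≤ C := (norm_nonneg _).trans (hC (S.pt 0))
  have hδ : ∀ i, ∀ x ∈ P i, dist (Φ x) (Φ (p i)) ≤ (1 / 2 : ℝ) ^ (n + 1) := by
    intro i x hx
    refine (hω _ _ _ ?_).le
    calc dist x (p i) ≤ Metric.diam (P i) :=
          Metric.dist_le_diam_of_mem (Metric.isBounded_of_compactSpace) hx (hpP i)
      _ < (1 / 2 : ℝ) ^ (ω (n + 1) + 1) := hdiam i
      _ ≤ (1 / 2 : ℝ) ^ ω (n + 1) :=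
          pow_le_pow_of_le_one (by norm_num) (by norm_num) (Nat.le_succ _)
  rw [← rotationVector_sum_smul]
  refine (dist_rotationVector_le Φ hP hδ hC μ _).trans ?_
  have := mul_le_mul_of_nonneg_left hwμ.le hC0
  -- Twice `2^{-(n+1)}` from the two Riemann sums plus `C * 2⁻ⁿ` from the masses.
  rw [pow_succ]
  linarith

theorem mainTheorem7 {X : Type*} [MetricSpace X] [CompactSpace X] [MeasurableSpace X] [BorelSpace X]
    (S : ComputableMetricSpace X) (f : X → X) (hf : Continuous f) (hfc : S.IsComputableFun S f)
    (m : ℕ) (Φ : C(X, EuclideanSpace ℝ (Fin m))) (hΦ : S.IsComputableFun (euclideanCMS m) Φ)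
    (ω : ℕ → ℕ) (hω : IsGlobalModulus Φ ω)
    (ψ : ℕ → List Nat.Partrec.Code × List (Nat.Partrec.Code × ℕ)) (hψ : Computable ψ)
    (hdata : ∀ n : ℕ, IsApproximatingData S f ω n (ψ n).1 (ψ n).2) :
    (euclideanCMS m).IsComputableSet (rotationSet f Φ) := by
  refine ⟨isCompact_rotationSet hf Φ, ?_⟩
  obtain ⟨C, hC⟩ := exists_nat_ge ‖Φ‖
  have hCΦ : ∀ x, ‖Φ x‖ ≤ C := fun x => (Φ.norm_coe_le_norm x).trans hC
  -- Querying `ψ` at `n + C` absorbs the factor `1 + C`, because `1 + C ≤ 2 ^ C`.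
  have hCpow : ∀ n, (1 + (C : ℝ)) * (1 / 2 : ℝ) ^ (n + C) ≤ (1 / 2 : ℝ) ^ n := by
    intro n
    have h1 : (1 + (C : ℝ)) ≤ 2 ^ C := by
      exact_mod_cast (Nat.add_comm 1 C).trans_le (Nat.succ_le_of_lt C.lt_two_pow_self)
    calc (1 + (C : ℝ)) * (1 / 2 : ℝ) ^ (n + C) ≤ 2 ^ C * (1 / 2 : ℝ) ^ (n + C) := by gcongr
      _ = (1 / 2 : ℝ) ^ n := by
        rw [pow_add, mul_left_comm, ← mul_pow]
        norm_num
  let B : ℕ → List (Code × ℕ) := fun n => (ψ (n + C)).2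
  have hB : Computable B := Computable.snd.comp (hψ.comp
    (Primrec.nat_add.to_comp.comp Computable.id (Computable.const C)))
  choose u hu huM hcov using fun n => (hdata (n + C)).exists_dist_le hf hω hCΦ
  obtain ⟨U, hU, hUspec⟩ := exists_computable_birkhoffAverage hfc hΦ hB (by
    intro n b hb
    obtain ⟨j, rfl⟩ := List.get_of_mem hb
    obtain ⟨h0, x, hx, -⟩ := hu n j
    exact ⟨h0, x, hx⟩)
  have hlen : ∀ n, (B n).length = (U n).length := fun n => (hUspec n).length_eq
  let V : ∀ n, Fin (B n).length → ℕ := fun n j => (U n)[j]'(hlen n ▸ j.2)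
  have hVu : ∀ n j, dist (ratPoint m (V n j)) (u n j) ≤ (1 / 2 : ℝ) ^ n := by
    intro n j
    obtain ⟨-, x, hx, hux⟩ := hu n j
    rw [hux]
    exact (hUspec n).get j.2 (hlen n ▸ j.2) x hx
  -- This makes the rounding error `l * C / K` at most `2⁻ⁿ`; the added 1 keeps `K` positive when `C
  -- = 0`.
  let K : ℕ → ℕ := fun n => (B n).length * C * 2 ^ n + 1
  have hK : ∀ n, 0 < K n := fun n => Nat.succ_pos _
  have hKle : ∀ n, ((B n).length : ℝ) * C / K n ≤ (1 / 2 : ℝ) ^ n := by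
    intro n
    rw [div_le_iff₀ (by exact_mod_cast hK n), one_div, inv_pow, ← div_eq_inv_mul,
      le_div_iff₀ (by positivity)]
    exact_mod_cast Nat.le_succ _
  have hKc : Computable K := by
    have h1 : Primrec fun n : ℕ => 2 ^ n := by
      have h2 : Primrec₂ fun _ p : ℕ => p * 2 :=
        Primrec.nat_mul.comp Primrec.snd (Primrec.const 2)
      refine (Primrec.nat_rec₁ 1 h2).of_eq fun n => ?_
      induction n with
      | zero => rfl
      | succ n ih => rw [pow_succ, ← ih]
    exact Computable.succ.comp (Primrec.nat_mul.to_comp.comp (Primrec.nat_mul.to_comp.comp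
      (Computable.list_length.comp hB) (Computable.const C)) h1.to_comp)
  have hdistV : ∀ n (T : List (Fin (B n).length)), T.length = K n →
      dist (ratPoint m (ratAverage m (T.map (V n)))) ((K n : ℝ)⁻¹ • (T.map (u n)).sum) ≤
        (1 / 2 : ℝ) ^ n := by
    intro n T hT
    rw [ratPoint_ratAverage m (by simpa [hT] using hK n), List.length_map, hT, List.map_map]
    refine List.dist_smul_sum_le (hK n) ?_ (by simpa using hT)
    rw [List.forall₂_map_left_iff, List.forall₂_map_right_iff]
    exact List.forall₂_same.2 fun j _ => hVu n j
  -- The machine enumerates tuples of values, while the estimates concern tuples of indices of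
  -- vertices.
  have hTuples : ∀ n t, t ∈ (U n).tuples (K n) ↔ ∃ T : List (Fin (B n).length),
      T.length = K n ∧ T.map (V n) = t := by
    intro n t
    have hrange : ∀ a, a ∈ U n ↔ a ∈ Set.range (V n) := by
      intro a
      rw [List.mem_iff_getElem]
      constructor
      · rintro ⟨i, hi, rfl⟩
        exact ⟨⟨i, (hlen n).symm ▸ hi⟩, rfl⟩
      · rintro ⟨j, rfl⟩
        exact ⟨j, hlen n ▸ j.2, rfl⟩
    simp only [List.mem_tuples, hrange]
    constructor
    · rintro ⟨h1, h2⟩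
      obtain ⟨T, rfl⟩ : t ∈ Set.range (List.map (V n)) := by rwa [Set.range_list_map]
      exact ⟨T, by simpa using h1, rfl⟩
    · rintro ⟨T, h1, rfl⟩
      exact ⟨by simpa using h1, by simp⟩
  have hpow : ∀ n, (1 / 2 : ℝ) ^ (n + 3) = (1 / 2 : ℝ) ^ n / 8 := fun n => by
    rw [pow_add]; norm_num; ring
  let out : ℕ → List (ℕ × ℤ) := fun n =>
    ((U n).tuples (K n)).map fun t => (ratAverage m t, (n : ℤ))
  have hcast : Primrec fun n : ℕ => (n : ℤ) :=
    -- A nonnegative integer `n` has code `2 * n`.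
    Primrec.encode_iff.1 ((Primrec.nat_mul.comp (Primrec.const 2) Primrec.id).of_eq fun _ => rfl)
  have hout : Computable out := by
    have h1 : Primrec fun p : List (List ℕ) × ℕ => p.1.map fun t => (ratAverage m t, (p.2 : ℤ)) :=
      Primrec.list_map Primrec.fst (((primrec_ratAverage m).comp Primrec.snd).pair
        (hcast.comp (Primrec.snd.comp Primrec.fst)))
    exact h1.to_comp.comp ((List.primrec_tuples.to_comp.comp hU hKc).pair Computable.id)
  refine ⟨fun N => out (N + 3), hout.comp
    (Primrec.nat_add.to_comp.comp Computable.id (Computable.const 3)), fun N => ?_⟩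
  have hN : (0 : ℝ) < (1 / 2 : ℝ) ^ N := by positivity
  -- At most three errors of `2^{-(N+3)}` occur in either direction: ball radius and vertex error
  -- for a point of a ball; covering, weight rounding and vertex error for a point of the rotation
  -- set. Their sum is `3/8` of the allowed `2^{-N}`.
  refine lt_of_le_of_lt (Metric.hausdorffEDist_le_of_mem_edist
    (r := ENNReal.ofReal (3 * (1 / 2 : ℝ) ^ (N + 3))) ?_ ?_)
    ((ENNReal.ofReal_lt_ofReal_iff hN).2 (by rw [hpow]; linarith))
  · intro x hx
    simp only [Set.mem_iUnion] at hx
    obtain ⟨b, hb, hx⟩ := hx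
    obtain ⟨t, ht, rfl⟩ := List.mem_map.1 hb
    obtain ⟨T, hT, rfl⟩ := (hTuples _ t).1 ht
    refine ⟨_, (convex_rotationSet hf Φ).smul_list_sum_mem (huM (N + 3)) (hK (N + 3)) hT, ?_⟩
    rw [edist_dist]
    refine ENNReal.ofReal_le_ofReal ?_
    have h1 := Metric.mem_closedBall.1 hx
    have h2 := hdistV _ T hT
    have h3 := dist_triangle x (ratPoint m (ratAverage m (T.map (V (N + 3)))))
      ((K (N + 3) : ℝ)⁻¹ • (T.map (u (N + 3))).sum)
    have h4 : (2 : ℝ) ^ (-((N + 3 : ℕ) : ℤ)) = (1 / 2 : ℝ) ^ (N + 3) := by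
      rw [zpow_neg, zpow_natCast, one_div, inv_pow]
    have h5 : dist x (ratPoint m (ratAverage m (T.map (V (N + 3))))) ≤ (1 / 2 : ℝ) ^ (N + 3) :=
      h1.trans_eq h4
    have h6 : (0 : ℝ) < (1 / 2 : ℝ) ^ (N + 3) := by positivity
    linarith
  · intro y hy
    obtain ⟨w, hw, hyw⟩ := hcov (N + 3) y hy
    obtain ⟨T, hT, hTw⟩ := exists_list_dist_sum_smul_le (u (N + 3)) (C := C) (by
      intro j
      obtain ⟨μ, hμ, hμu⟩ := huM (N + 3) j
      have := hμ.1
      rw [← hμu, rotationVector_eq_integral]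
      simpa using norm_integral_le_of_norm_le_const (μ := μ) (.of_forall hCΦ)) w hw (hK (N + 3))
    refine ⟨ratPoint m (ratAverage m (T.map (V (N + 3)))), ?_, ?_⟩
    · simp only [Set.mem_iUnion]
      refine ⟨_, List.mem_map_of_mem ((hTuples _ _).2 ⟨T, hT, rfl⟩), ?_⟩
      exact Metric.mem_closedBall_self (by positivity)
    · rw [edist_dist]
      refine ENNReal.ofReal_le_ofReal ?_
      have h1 := hyw.trans (hCpow _)
      have h2 := hTw.trans (hKle _)
      have h3 := hdistV _ T hT
      rw [dist_comm] at h3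
      refine (dist_triangle4 _ _ _ _).trans ((add_le_add (add_le_add h1 h2) h3).trans_eq ?_)
      ring
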